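/- **Games.** Let $A$ be a totally ordered abelian group. A (short) game with adorns in $A$ is $G=\langle G^{\mathcal L}\mid G^{\mathcal R}\rangle$, where each side is either a finite non-empty list of games (the Left, respectively Right, options) or an atom $\emptyset^a$ with $a\in A$, meaning that the player has no option there; trees have finite depth. $G$ is left-atomic (right-atomic) if Left (Right) has no option. Followers of $G$ are $G$, its options, their options, and so on. In the disjunctive sum $G+H$ the Left options are all $G^L+H$ and $G+H^L$, the Right options are all $G^R+H$ and $G+H^R$, and a side with no options in either summand is the atom whose adorn is the sum of the two adorns on that side. **Outcomes.** Let $\nu_L,\nu_R:A\to S$ be order preserving maps to a totally ordered set. Put $o_L(G)=\nu_L(\ell)$ if $G^{\mathcal L}=\emptyset^\ell$ and $o_L(G)=\max_{G^L} o_R(G^L)$ otherwise; $o_R(G)=\nu_R(r)$ if $G^{\mathcal R}=\emptyset^r$ and $o_R(G)=\min_{G^R}o_L(G^R)$ otherwise. Write $o(G)\ge o(H)$ if $o_L(G)\ge o_L(H)$ and $o_R(G)\ge o_R(H)$. Normal play: $A=\{0\}$, $S=\{-1,+1\}$, $\nu_L(0)=-1$, $\nu_R(0)=+1$. Misère play: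 $A=\{0\}$, $S=\{-1,+1\}$, $\nu_L(0)=+1$, $\nu_R(0)=-1$. Scoring play: $A$ is non-trivial and $\nu_L=\nu_R=\nu$ is strictly increasing (for instance $A=S=\mathbb R$ and $\nu=\mathrm{id}$). **Universes.** The normal-play universe and the free misère space consist of all games with adorns in $\{0\}$. The dicot misère and the dicot scoring universe consist of the games in which every follower either has options for both players or is of the form $\langle\emptyset^a\mid\emptyset^a\rangle$. The guaranteed scoring universe consists of the games such that, for every follower $K$, $K^{\mathcal L}=\emptyset^{\ell}$ implies $\ell\le s$, and $K^{\mathcal R}=\emptyset^{r}$ implies $s\le r$, for every adorn $s$ occurring in $K$ or its followers. **Order.** For $G,H$ in a universe $\mathbb U$, $G\succcurlyeq_{\mathbb U}H$ means $o_L(G+X)\ge o_L(H+X)$ and $o_R(G+X)\ge o_R(H+X)$ for all $X\in\mathbb U$. The *Common Normal Part* for $(G,H)$ says: 1. for every $G^R$ there is $H^R$ with $G^R\succcurlyeq_{\mathbb U}H^R$, or there is $G^{RL}$ with $G^{RL}\succcurlyeq_{\mathbb U}H$; 2. for every $H^L$ there is $G^L$ with $G^L\succcurlyeq_{\mathbb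 U}H^L$, or there is $H^{LR}$ with $G\succcurlyeq_{\mathbb U}H^{LR}$. For $n\ge 0$ let $\overline n$ be the game of $n$ consecutive moves for Left, i.e. $\overline 0=\langle\emptyset^0\mid\emptyset^0\rangle$, $\overline{n+1}=\langle\overline n\mid\emptyset^0\rangle$; for $n\le 0$ let $\underline n$ be the game of $|n|$ consecutive moves for Right, i.e. $\underline 0=\langle\emptyset^0\mid\emptyset^0\rangle$, $\underline{n-1}=\langle\emptyset^0\mid\underline n\rangle$. **Theorem (Subordinate game comparison).** Let $\mathbb U$ be one of the universes below and $G,H\in\mathbb U$. Then $G\succcurlyeq_{\mathbb U}H$ if and only if the Common Normal Part holds for $(G,H)$ and, moreover: - if $\mathbb U$ is the normal-play universe: no further condition; - if $\mathbb U$ is the dicot misère universe: $o(G)\ge o(H)$; - if $\mathbb U$ is the free misère space: $H^{\mathcal L}=\emptyset^0\Rightarrow G^{\mathcal L}=\emptyset^0$, and $G^{\mathcal R}=\emptyset^0\Rightarrow H^{\mathcal R}=\emptyset^0$; - if $\mathbb U$ is the dicot scoring universe: $o(G)\ge o(H)$; - if $\mathbb U$ is the guaranteed scoring universe: $\underline o_L(G)\ge\underline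 o_L(H)$ and $\overline o_R(G)\ge\overline o_R(H)$, where $\underline o_L(G)=\min\{o_L(G+\underline n):n\le 0\}$ and $\overline o_R(G)=\max\{o_R(G+\overline n):n\ge 0\}$ (these minima and maxima exist). -/

import Mathlib

/-- Short games with adorns in `A`, in literal form: a game has finite lists of `m` Left options and
`n` Right options. A side carries an adorn exactly when it has no options, so for instance
`mk 0 1 l r L R` is the left-atomic game `⟨∅^ℓ ∣ L⟩` with `ℓ = l rfl`. -/
inductive CGame (A : Type*) : Type _
  | mk (m n : ℕ) (l : m = 0 → A) (r : n = 0 → A)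
      (L : Fin m → CGame A) (R : Fin n → CGame A) : CGame A

namespace CGame

variable {A : Type*}

/-- The number of Left options. -/
def numL : CGame A → ℕ
  | mk m _ _ _ _ _ => m

/-- The number of Right options. -/
def numR : CGame A → ℕ
  | mk _ n _ _ _ _ => n

/-- The Left options. -/
def optL : (G : CGame A) → Fin G.numL → CGame A
  | mk _ _ _ _ L _ => L

/-- The Right options. -/
def optR : (G : CGame A) → Fin G.numR → CGame A
  | mk _ _ _ _ _ R => R

/-- `G` is left-atomic: Left has no option. -/
def LeftAtomic (G : CGame A) : Prop := G.numL = 0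

/-- `G` is right-atomic: Right has no option. -/
def RightAtomic (G : CGame A) : Prop := G.numR = 0

/-- The purely atomic game `⟨∅^a ∣ ∅^b⟩`. -/
def pureAtom (a b : A) : CGame A :=
  mk 0 0 (fun _ => a) (fun _ => b) Fin.elim0 Fin.elim0

/-- Recursion on the second summand in the disjunctive sum; `fL i K` and `fR j K` stand for
`G^L + K` and `G^R + K`. -/
def addAux [Add A] (m n : ℕ) (l : m = 0 → A) (r : n = 0 → A)
    (fL : Fin m → CGame A → CGame A) (fR : Fin n → CGame A → CGame A) : CGame A → CGame A
  | mk m' n' l' r' L' R' =>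
    mk (m + m') (n + n')
      (fun h => l (Nat.add_eq_zero_iff.mp h).1 + l' (Nat.add_eq_zero_iff.mp h).2)
      (fun h => r (Nat.add_eq_zero_iff.mp h).1 + r' (Nat.add_eq_zero_iff.mp h).2)
      (Fin.append (fun i => fL i (mk m' n' l' r' L' R')) (fun j => addAux m n l r fL fR (L' j)))
      (Fin.append (fun i => fR i (mk m' n' l' r' L' R')) (fun j => addAux m n l r fL fR (R' j)))

/-- The disjunctive sum: the options are `G^L + H`, `G + H^L` and `G^R + H`, `G + H^R`; a side
without options gets the sum of the two adorns. -/
def add [Add A] : CGame A → CGame A → CGame A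
  | mk m n l r L R => addAux m n l r (fun i => add (L i)) (fun j => add (R j))

instance [Add A] : Add (CGame A) := ⟨add⟩

/-- `s` is an adorn of `G` or of a follower of `G`. -/
def IsAdorn (s : A) : CGame A → Prop
  | mk _ _ l r L R =>
    (∃ h, l h = s) ∨ (∃ h, r h = s) ∨ (∃ i, IsAdorn s (L i)) ∨ (∃ j, IsAdorn s (R j))

/-- Dicot games: in every follower either both players have an option, or the game is over and the
follower is `⟨∅^a ∣ ∅^a⟩` for some `a`. -/
def IsDicot : CGame A → Prop
  | mk m n l r L R =>
    (m = 0 ↔ n = 0) ∧ (∀ hm hn, l hm = r hn) ∧ (∀ i, IsDicot (L i)) ∧ (∀ j, IsDicot (R j))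

/-- Guaranteed games: in every follower `K`, if Left has no option then the adorn on that side is at
most every adorn occurring in `K` and its followers, and if Right has no option then the adorn on
that side is at least every adorn occurring in `K` and its followers. -/
def IsGuaranteed [LE A] : CGame A → Prop
  | mk m n l r L R =>
    (∀ h, ∀ s, IsAdorn s (mk m n l r L R) → l h ≤ s) ∧
    (∀ h, ∀ s, IsAdorn s (mk m n l r L R) → s ≤ r h) ∧
    (∀ i, IsGuaranteed (L i)) ∧ (∀ j, IsGuaranteed (R j))

/-- `k` consecutive moves for Left, all adorns being `0` (the literal form of the integer `k`). -/
def leftMoves [Zero A] : ℕ → CGame A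
  | 0 => pureAtom 0 0
  | k + 1 => mk 1 0 (fun _ => 0) (fun _ => 0) (fun _ => leftMoves k) Fin.elim0

/-- `k` consecutive moves for Right, all adorns being `0` (the literal form of the integer `-k`). -/
def rightMoves [Zero A] : ℕ → CGame A
  | 0 => pureAtom 0 0
  | k + 1 => mk 0 1 (fun _ => 0) (fun _ => 0) Fin.elim0 (fun _ => rightMoves k)

end CGame

/-- A combinatorial game space over the free space of games with adorns in `A`: the two order
preserving evaluation maps into the totally ordered set `S`, equal if `A` is non-trivial. -/
structure GameSpace (A S : Type*) [LinearOrder A] [LinearOrder S] where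
  nuL : A → S
  nuR : A → S
  monotone_nuL : Monotone nuL
  monotone_nuR : Monotone nuR
  scoring : Nontrivial A → nuL = nuR

namespace GameSpace

/-- Normal play: trivial group of adorns, results `-1 < 1`; a player who cannot move loses. -/
def normalPlay : GameSpace Unit ℤˣ where
  nuL _ := -1
  nuR _ := 1
  monotone_nuL := monotone_const
  monotone_nuR := monotone_const
  scoring h := absurd h (not_nontrivial Unit)

/-- Misère play: trivial group of adorns, results `-1 < 1`; a player who cannot move wins. -/
def misere : GameSpace Unit ℤˣ where
  nuL _ := 1
  nuR _ := -1
  monotone_nuL := monotone_const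
  monotone_nuR := monotone_const
  scoring h := absurd h (not_nontrivial Unit)

variable {A S : Type*}

/-- Scoring play with evaluation map `ν`. -/
def scoringPlay [LinearOrder A] [LinearOrder S] (ν : A → S) (hν : StrictMono ν) : GameSpace A S where
  nuL := ν
  nuR := ν
  monotone_nuL := hν.monotone
  monotone_nuR := hν.monotone
  scoring _ := rfl

/-- The outcome `(o_L(G), o_R(G))`. -/
def outcome [LinearOrder A] [LinearOrder S] (Ω : GameSpace A S) : CGame A → S × S
  | .mk m n l r L R =>
    (if h : m = 0 then Ω.nuL (l h)
      else Finset.univ.sup' ⟨⟨0, Nat.pos_of_ne_zero h⟩, Finset.mem_univ _⟩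
        (fun i => (Ω.outcome (L i)).2),
     if h : n = 0 then Ω.nuR (r h)
      else Finset.univ.inf' ⟨⟨0, Nat.pos_of_ne_zero h⟩, Finset.mem_univ _⟩
        (fun j => (Ω.outcome (R j)).1))

/-- The left-outcome: the result under optimal play when Left starts. -/
def oL [LinearOrder A] [LinearOrder S] (Ω : GameSpace A S) (G : CGame A) : S := (Ω.outcome G).1

/-- The right-outcome: the result under optimal play when Right starts. -/
def oR [LinearOrder A] [LinearOrder S] (Ω : GameSpace A S) (G : CGame A) : S := (Ω.outcome G).2

/-- `o(G) ≥ o(H)`. -/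
def OutcomeGE [LinearOrder A] [LinearOrder S] (Ω : GameSpace A S) (G H : CGame A) : Prop :=
  Ω.oL G ≥ Ω.oL H ∧ Ω.oR G ≥ Ω.oR H

/-- `G ≽ H` modulo the universe `U`. -/
def GameGE [LinearOrder A] [Add A] [LinearOrder S] (Ω : GameSpace A S) (U : Set (CGame A))
    (G H : CGame A) : Prop :=
  ∀ X ∈ U, Ω.oL (G + X) ≥ Ω.oL (H + X) ∧ Ω.oR (G + X) ≥ Ω.oR (H + X)

/-- The Common Normal Part for the pair `(G, H)` in the universe `U`. -/
def CommonNormalPart [LinearOrder A] [Add A] [LinearOrder S] (Ω : GameSpace A S) (U : Set (CGame A))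
    (G H : CGame A) : Prop :=
  (∀ i, (∃ j, Ω.GameGE U (G.optR i) (H.optR j)) ∨
    (∃ j, Ω.GameGE U ((G.optR i).optL j) H)) ∧
  (∀ i, (∃ j, Ω.GameGE U (G.optL j) (H.optL i)) ∨
    (∃ j, Ω.GameGE U G ((H.optL i).optR j)))

/-- `s` is the pass-allowed left-outcome `min {o_L(G + n) : n ≤ 0}` of `G`. -/
def IsPassAllowedL [LinearOrder A] [AddZeroClass A] [LinearOrder S] (Ω : GameSpace A S)
    (G : CGame A) (s : S) : Prop :=
  IsLeast (Set.range fun k : ℕ => Ω.oL (G + CGame.rightMoves k)) s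

/-- `s` is the pass-allowed right-outcome `max {o_R(G + n) : n ≥ 0}` of `G`. -/
def IsPassAllowedR [LinearOrder A] [AddZeroClass A] [LinearOrder S] (Ω : GameSpace A S)
    (G : CGame A) (s : S) : Prop :=
  IsGreatest (Set.range fun k : ℕ => Ω.oR (G + CGame.leftMoves k)) s

end GameSpace

/-! ### Literal games: options, adorns and followers. -/

namespace CGame

variable {A : Type*}

/-! Necessity of the Common Normal Part uses three properties of the universe, bundled with a
threshold `s₀` in `IsAbsolute`. It is parental; for every G in it some W gives o_L(G+W) < s₀ and
some W gives s₀ ≤ o_R(G+W); and any two differing outcomes can be made to straddle s₀. Hence G ⋡ H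
is witnessed across s₀ both with Left starting and with Right starting. If no G^L ≽ H and no H^R
satisfies G ≽ H^R, these witnesses glue to one game T with o_L(G+T) < s₀ ≤ o_R(H+T)
(`exists_linked`). If G ≽ H but the first clause fails at G^R, then G^R is linked to H in this way,
and o_L(G^R+T) < o_R(H+T) ≤ o_R(G+T) is absurd because Right may move from G to G^R. The second
clause is symmetric.

Sufficiency is an induction on the test game X (`gameGE_of_commonNormalPart`). The Common Normal
Part answers moves in the compared games and the induction answers moves in X. What remains is the
end of play: H and X both left-atomic, or G and X both right-atomic.

The extra condition of each universe is what settles this end. In normal play a stuck player already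
has the worst result. In free misère play G is then left-atomic too (or H right-atomic). An atomic
dicot X is a pure atom, which only translates outcomes. A guaranteed left-atomic X is no worse for
Left than a long supply of Right moves plus its Left adorn
(`le_outcome_add_of_le_outcome_add_rightMoves`), whence the pass-allowed outcomes. Conversely the
extra conditions follow by testing with 0, with integers, or, in free misère play, with a tailored
one-sided game. -/

theorem opt_induction {P : CGame A → Prop}
    (h : ∀ G : CGame A, (∀ i, P (G.optL i)) → (∀ j, P (G.optR j)) → P G) (G : CGame A) : P G := by
  induction G with
  | mk m n l r L R ihL ihR => exact h _ ihL ihR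

/-- The adorn of the empty Left side of a left-atomic game. -/
def adornL : (G : CGame A) → G.LeftAtomic → A
  | mk _ _ l _ _ _ => l

/-- The adorn of the empty Right side of a right-atomic game. -/
def adornR : (G : CGame A) → G.RightAtomic → A
  | mk _ _ _ r _ _ => r

/-- The game obtained from `G` by adding `c` to every adorn. -/
def shift [Add A] (c : A) : CGame A → CGame A
  | mk m n l r L R =>
    mk m n (fun h => l h + c) (fun h => r h + c) (fun i => shift c (L i)) (fun j => shift c (R j))

theorem isAdorn_iff {s : A} {G : CGame A} : IsAdorn s G ↔
    (∃ h, G.adornL h = s) ∨ (∃ h, G.adornR h = s) ∨ (∃ i, IsAdorn s (G.optL i)) ∨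
      (∃ j, IsAdorn s (G.optR j)) := by
  cases G; rfl

theorem isDicot_iff {G : CGame A} : IsDicot G ↔
    (G.LeftAtomic ↔ G.RightAtomic) ∧ (∀ hm hn, G.adornL hm = G.adornR hn) ∧
      (∀ i, IsDicot (G.optL i)) ∧ (∀ j, IsDicot (G.optR j)) := by
  cases G; rfl

theorem isGuaranteed_iff [LE A] {G : CGame A} : IsGuaranteed G ↔
    (∀ h, ∀ s, IsAdorn s G → G.adornL h ≤ s) ∧ (∀ h, ∀ s, IsAdorn s G → s ≤ G.adornR h) ∧
      (∀ i, IsGuaranteed (G.optL i)) ∧ (∀ j, IsGuaranteed (G.optR j)) := by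
  cases G; rfl

theorem not_leftAtomic_of_opt {G : CGame A} (i : Fin G.numL) : ¬ G.LeftAtomic :=
  fun h => (Fin.cast h i).elim0

theorem not_rightAtomic_of_opt {G : CGame A} (i : Fin G.numR) : ¬ G.RightAtomic :=
  fun h => (Fin.cast h i).elim0

theorem exists_optL {G : CGame A} (h : ¬ G.LeftAtomic) : Nonempty (Fin G.numL) :=
  ⟨⟨0, Nat.pos_of_ne_zero h⟩⟩

theorem exists_optR {G : CGame A} (h : ¬ G.RightAtomic) : Nonempty (Fin G.numR) :=
  ⟨⟨0, Nat.pos_of_ne_zero h⟩⟩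

theorem finite_isAdorn (G : CGame A) : {s | IsAdorn s G}.Finite := by
  induction G using opt_induction with
  | h G ihL ihR =>
    have : {s | IsAdorn s G} = (Set.range G.adornL) ∪ ((Set.range G.adornR) ∪
        ((⋃ i, {s | IsAdorn s (G.optL i)}) ∪ ⋃ j, {s | IsAdorn s (G.optR j)})) := by
      ext s
      simp only [Set.mem_ofPred_eq, Set.mem_union, Set.mem_range, Set.mem_iUnion]
      exact isAdorn_iff
    rw [this]
    exact (Set.finite_range _).union ((Set.finite_range _).union
      ((Set.finite_iUnion ihL).union (Set.finite_iUnion ihR)))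

/-! ### Disjunctive sums and shifts of adorns. -/

section Sum

variable [Add A]

/-- Quantifying over a predicate hides the index type `Fin (m + m')` of the options of a sum, so
later proofs never meet `Fin.append`. -/
theorem forall_optL_add {P : CGame A → Prop} {G X : CGame A} :
    (∀ k, P ((G + X).optL k)) ↔ (∀ i, P (G.optL i + X)) ∧ ∀ i, P (G + X.optL i) := by
  cases G with | mk m n l r L R =>
  cases X with | mk m' n' l' r' L' R' =>
  change (∀ k : Fin (m + m'), P (Fin.append (fun i => L i + mk m' n' l' r' L' R')
    (fun j => mk m n l r L R + L' j) k)) ↔ (∀ i : Fin m, P (L i + mk m' n' l' r' L' R')) ∧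
      ∀ i : Fin m', P (mk m n l r L R + L' i)
  constructor
  · intro h
    exact ⟨fun i => by simpa using h (Fin.castAdd m' i), fun i => by simpa using h (Fin.natAdd m i)⟩
  · rintro ⟨h, h'⟩ k
    refine Fin.addCases (fun i => ?_) (fun i => ?_) k
    · simpa using h i
    · simpa using h' i

theorem forall_optR_add {P : CGame A → Prop} {G X : CGame A} :
    (∀ k, P ((G + X).optR k)) ↔ (∀ i, P (G.optR i + X)) ∧ ∀ i, P (G + X.optR i) := by
  cases G with | mk m n l r L R =>
  cases X with | mk m' n' l' r' L' R' =>
  change (∀ k : Fin (n + n'), P (Fin.append (fun i => R i + mk m' n' l' r' L' R')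
    (fun j => mk m n l r L R + R' j) k)) ↔ (∀ i : Fin n, P (R i + mk m' n' l' r' L' R')) ∧
      ∀ i : Fin n', P (mk m n l r L R + R' i)
  constructor
  · intro h
    exact ⟨fun i => by simpa using h (Fin.castAdd n' i), fun i => by simpa using h (Fin.natAdd n i)⟩
  · rintro ⟨h, h'⟩ k
    refine Fin.addCases (fun i => ?_) (fun i => ?_) k
    · simpa using h i
    · simpa using h' i

theorem forall_adornL_add {P : A → Prop} {G X : CGame A} :
    (∀ h, P ((G + X).adornL h)) ↔ ∀ h h', P (G.adornL h + X.adornL h') := by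
  cases G with | mk m n l r L R =>
  cases X with | mk m' n' l' r' L' R' =>
  exact ⟨fun h h₁ h₂ => h (Nat.add_eq_zero_iff.mpr ⟨h₁, h₂⟩),
    fun h h₁ => h (Nat.add_eq_zero_iff.mp h₁).1 (Nat.add_eq_zero_iff.mp h₁).2⟩

theorem forall_adornR_add {P : A → Prop} {G X : CGame A} :
    (∀ h, P ((G + X).adornR h)) ↔ ∀ h h', P (G.adornR h + X.adornR h') := by
  cases G with | mk m n l r L R =>
  cases X with | mk m' n' l' r' L' R' =>
  exact ⟨fun h h₁ h₂ => h (Nat.add_eq_zero_iff.mpr ⟨h₁, h₂⟩),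
    fun h h₁ => h (Nat.add_eq_zero_iff.mp h₁).1 (Nat.add_eq_zero_iff.mp h₁).2⟩

theorem exists_of_isAdorn_add {G X : CGame A} :
    ∀ s, IsAdorn s (G + X) → ∃ a b, IsAdorn a G ∧ IsAdorn b X ∧ s = a + b := by
  induction G using opt_induction generalizing X with
  | h G ihL ihR =>
  induction X using opt_induction with
  | h X ihL' ihR' =>
    intro s hs
    have hl : ∀ i, ∀ s, IsAdorn s ((G + X).optL i) →
        ∃ a b, IsAdorn a G ∧ IsAdorn b X ∧ s = a + b := by
      refine (forall_optL_add (P := fun K => ∀ s, IsAdorn s K →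
        ∃ a b, IsAdorn a G ∧ IsAdorn b X ∧ s = a + b)).2 ⟨fun i s hs => ?_, fun i s hs => ?_⟩
      · obtain ⟨a, b, ha, hb, h⟩ := ihL i s hs
        exact ⟨a, b, isAdorn_iff.2 (Or.inr (Or.inr (Or.inl ⟨i, ha⟩))), hb, h⟩
      · obtain ⟨a, b, ha, hb, h⟩ := ihL' i s hs
        exact ⟨a, b, ha, isAdorn_iff.2 (Or.inr (Or.inr (Or.inl ⟨i, hb⟩))), h⟩
    have hr : ∀ i, ∀ s, IsAdorn s ((G + X).optR i) →
        ∃ a b, IsAdorn a G ∧ IsAdorn b X ∧ s = a + b := by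
      refine (forall_optR_add (P := fun K => ∀ s, IsAdorn s K →
        ∃ a b, IsAdorn a G ∧ IsAdorn b X ∧ s = a + b)).2 ⟨fun i s hs => ?_, fun i s hs => ?_⟩
      · obtain ⟨a, b, ha, hb, h⟩ := ihR i s hs
        exact ⟨a, b, isAdorn_iff.2 (Or.inr (Or.inr (Or.inr ⟨i, ha⟩))), hb, h⟩
      · obtain ⟨a, b, ha, hb, h⟩ := ihR' i s hs
        exact ⟨a, b, ha, isAdorn_iff.2 (Or.inr (Or.inr (Or.inr ⟨i, hb⟩))), h⟩
    have hal : ∀ h, ∃ a b, IsAdorn a G ∧ IsAdorn b X ∧ (G + X).adornL h = a + b :=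
      (forall_adornL_add (P := fun s => ∃ a b, IsAdorn a G ∧ IsAdorn b X ∧ s = a + b)).2
        fun h h' => ⟨_, _, isAdorn_iff.2 (Or.inl ⟨h, rfl⟩), isAdorn_iff.2 (Or.inl ⟨h', rfl⟩), rfl⟩
    have har : ∀ h, ∃ a b, IsAdorn a G ∧ IsAdorn b X ∧ (G + X).adornR h = a + b :=
      (forall_adornR_add (P := fun s => ∃ a b, IsAdorn a G ∧ IsAdorn b X ∧ s = a + b)).2
        fun h h' => ⟨_, _, isAdorn_iff.2 (Or.inr (Or.inl ⟨h, rfl⟩)),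
          isAdorn_iff.2 (Or.inr (Or.inl ⟨h', rfl⟩)), rfl⟩
    rcases isAdorn_iff.1 hs with ⟨h, rfl⟩ | ⟨h, rfl⟩ | ⟨i, h⟩ | ⟨i, h⟩
    · exact hal h
    · exact har h
    · exact hl i s h
    · exact hr i s h

theorem exists_of_isAdorn_shift {c : A} {X : CGame A} :
    ∀ s, IsAdorn s (shift c X) → ∃ t, IsAdorn t X ∧ s = t + c := by
  induction X with
  | mk m n l r L R ihL ihR =>
    rintro s (⟨h, rfl⟩ | ⟨h, rfl⟩ | ⟨i, h⟩ | ⟨i, h⟩)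
    · exact ⟨_, Or.inl ⟨h, rfl⟩, rfl⟩
    · exact ⟨_, Or.inr (Or.inl ⟨h, rfl⟩), rfl⟩
    · obtain ⟨t, ht, rfl⟩ := ihL i s h
      exact ⟨t, Or.inr (Or.inr (Or.inl ⟨i, ht⟩)), rfl⟩
    · obtain ⟨t, ht, rfl⟩ := ihR i s h
      exact ⟨t, Or.inr (Or.inr (Or.inr ⟨i, ht⟩)), rfl⟩

theorem IsDicot.shift {X : CGame A} (c : A) (h : IsDicot X) : IsDicot (shift c X) := by
  induction X with
  | mk m n l r L R ihL ihR =>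
    obtain ⟨h₁, h₂, h₃, h₄⟩ := h
    exact ⟨h₁, fun hm hn => congrArg (· + c) (h₂ hm hn), fun i => ihL i (h₃ i),
      fun j => ihR j (h₄ j)⟩

end Sum

theorem IsGuaranteed.shift [AddCommGroup A] [LinearOrder A] [IsOrderedAddMonoid A] {X : CGame A}
    (c : A) (h : IsGuaranteed X) : IsGuaranteed (shift c X) := by
  induction X with
  | mk m n l r L R ihL ihR =>
    obtain ⟨h₁, h₂, h₃, h₄⟩ := h
    refine ⟨fun h s hs => ?_, fun h s hs => ?_, fun i => ihL i (h₃ i), fun j => ihR j (h₄ j)⟩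
    · obtain ⟨t, ht, rfl⟩ := exists_of_isAdorn_shift (X := mk m n l r L R) s hs
      exact add_le_add_left (h₁ h t ht) c
    · obtain ⟨t, ht, rfl⟩ := exists_of_isAdorn_shift (X := mk m n l r L R) s hs
      exact add_le_add_left (h₂ h t ht) c

/-! ### Test games: pure atoms and integers. -/

theorem eq_of_isAdorn_pureAtom {a s : A} (h : IsAdorn s (pureAtom a a)) : s = a := by
  rcases h with ⟨_, h⟩ | ⟨_, h⟩ | ⟨i, _⟩ | ⟨i, _⟩
  · exact h.symm
  · exact h.symm
  · exact i.elim0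
  · exact i.elim0

theorem isDicot_pureAtom (a : A) : IsDicot (pureAtom a a) :=
  ⟨Iff.rfl, fun _ _ => rfl, fun i => i.elim0, fun i => i.elim0⟩

theorem isGuaranteed_pureAtom [Preorder A] (a : A) : IsGuaranteed (pureAtom a a) :=
  ⟨fun _ _ hs => (eq_of_isAdorn_pureAtom hs).ge, fun _ _ hs => (eq_of_isAdorn_pureAtom hs).le,
    fun i => i.elim0, fun i => i.elim0⟩

theorem shift_pureAtom_zero [AddZeroClass A] (a : A) :
    shift a (pureAtom (0 : A) 0) = pureAtom a a := by
  simp only [pureAtom, shift, zero_add]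
  congr 1 <;> exact funext fun i => i.elim0

/-- In the dicot universes this reduces the end-of-play comparison to plain outcomes. -/
theorem IsDicot.eq_pureAtom_of_leftAtomic {X : CGame A} (h : IsDicot X) (hX : X.LeftAtomic) :
    ∃ a, X = pureAtom a a := by
  cases X with | mk m n l r L R =>
  obtain rfl : m = 0 := hX
  obtain rfl : n = 0 := h.1.1 rfl
  have := h.2.1 rfl rfl
  refine ⟨l rfl, ?_⟩
  simp only [pureAtom]
  congr 1
  · exact funext fun _ => this.symm
  · exact funext fun i => i.elim0
  · exact funext fun i => i.elim0

theorem eq_zero_of_isAdorn_leftMoves [Zero A] {s : A} {k : ℕ} (h : IsAdorn s (leftMoves k)) :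
    s = 0 := by
  induction k with
  | zero => exact eq_of_isAdorn_pureAtom h
  | succ k ih =>
    rcases h with ⟨_, h⟩ | ⟨_, h⟩ | ⟨_, h⟩ | ⟨i, _⟩
    · exact h.symm
    · exact h.symm
    · exact ih h
    · exact i.elim0

theorem eq_zero_of_isAdorn_rightMoves [Zero A] {s : A} {k : ℕ} (h : IsAdorn s (rightMoves k)) :
    s = 0 := by
  induction k with
  | zero => exact eq_of_isAdorn_pureAtom h
  | succ k ih =>
    rcases h with ⟨_, h⟩ | ⟨_, h⟩ | ⟨i, _⟩ | ⟨_, h⟩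
    · exact h.symm
    · exact h.symm
    · exact i.elim0
    · exact ih h

theorem isGuaranteed_leftMoves [Zero A] [Preorder A] (k : ℕ) :
    IsGuaranteed (leftMoves k : CGame A) := by
  induction k with
  | zero => exact isGuaranteed_pureAtom 0
  | succ k ih =>
    exact ⟨fun h => absurd h one_ne_zero,
      fun _ _ hs => (eq_zero_of_isAdorn_leftMoves (k := k + 1) hs).le, fun _ => ih,
      fun i => i.elim0⟩

theorem isGuaranteed_rightMoves [Zero A] [Preorder A] (k : ℕ) :
    IsGuaranteed (rightMoves k : CGame A) := by
  induction k with
  | zero => exact isGuaranteed_pureAtom 0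
  | succ k ih =>
    exact ⟨fun _ _ hs => (eq_zero_of_isAdorn_rightMoves (k := k + 1) hs).ge,
      fun h => absurd h one_ne_zero, fun i => i.elim0, fun _ => ih⟩

theorem rightMoves_leftAtomic [Zero A] (k : ℕ) : (rightMoves k : CGame A).LeftAtomic := by
  cases k <;> rfl

theorem leftMoves_rightAtomic [Zero A] (k : ℕ) : (leftMoves k : CGame A).RightAtomic := by
  cases k <;> rfl

/-- The birthday: the height of the game tree. -/
def height : CGame A → ℕ
  | mk _ _ _ _ L R =>
    max (Finset.univ.sup fun i => height (L i) + 1) (Finset.univ.sup fun j => height (R j) + 1)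

theorem height_optL_lt (G : CGame A) (i : Fin G.numL) : (G.optL i).height < G.height := by
  cases G with | mk m n l r L R =>
  exact lt_of_lt_of_le (Nat.lt_succ_self _)
    ((Finset.le_sup (f := fun i => height (L i) + 1) (Finset.mem_univ i)).trans (le_max_left _ _))

theorem height_optR_lt (G : CGame A) (i : Fin G.numR) : (G.optR i).height < G.height := by
  cases G with | mk m n l r L R =>
  exact lt_of_lt_of_le (Nat.lt_succ_self _)
    ((Finset.le_sup (f := fun i => height (R i) + 1) (Finset.mem_univ i)).trans (le_max_right _ _))

/-- A set of games that contains the options of its members. -/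
structure Hereditary (U : Set (CGame A)) : Prop where
  optL : ∀ G ∈ U, ∀ i, G.optL i ∈ U
  optR : ∀ G ∈ U, ∀ i, G.optR i ∈ U

/-- A set of games is parental if it contains every game with options for both players, all of which
are in the set. -/
def Parental (U : Set (CGame A)) : Prop :=
  ∀ (m n : ℕ) (L : Fin (m + 1) → CGame A) (R : Fin (n + 1) → CGame A),
    (∀ i, L i ∈ U) → (∀ j, R j ∈ U) →
      mk (m + 1) (n + 1) (fun h => absurd h m.succ_ne_zero) (fun h => absurd h n.succ_ne_zero) L R ∈ U

theorem hereditary_univ : Hereditary (Set.univ : Set (CGame A)) :=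
  ⟨fun _ _ _ => trivial, fun _ _ _ => trivial⟩

theorem parental_univ : Parental (Set.univ : Set (CGame A)) :=
  fun _ _ _ _ _ _ => trivial

theorem hereditary_isDicot : Hereditary {X : CGame A | IsDicot X} :=
  ⟨fun _ hG => (isDicot_iff.1 hG).2.2.1, fun _ hG => (isDicot_iff.1 hG).2.2.2⟩

theorem parental_isDicot : Parental {X : CGame A | IsDicot X} :=
  fun m n _ _ hL hR => ⟨⟨fun h => absurd h m.succ_ne_zero, fun h => absurd h n.succ_ne_zero⟩,
    fun h => absurd h m.succ_ne_zero, hL, hR⟩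

theorem hereditary_isGuaranteed [LE A] : Hereditary {X : CGame A | IsGuaranteed X} :=
  ⟨fun _ hG => (isGuaranteed_iff.1 hG).2.2.1, fun _ hG => (isGuaranteed_iff.1 hG).2.2.2⟩

theorem parental_isGuaranteed [LE A] : Parental {X : CGame A | IsGuaranteed X} :=
  fun m n _ _ hL hR => ⟨fun h => absurd h m.succ_ne_zero, fun h => absurd h n.succ_ne_zero, hL, hR⟩

end CGame

/-! ### Outcomes of games and of sums. -/

namespace GameSpace

open CGame

variable {A S : Type*} [LinearOrder A] [LinearOrder S] {Ω : GameSpace A S}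

/-- Exactly one of the two conjuncts has content: the first is vacuous unless `G` is left-atomic,
the second if it is. This replaces the case split in `outcome`. -/
theorem oL_lt_iff {G : CGame A} {s : S} :
    Ω.oL G < s ↔ (∀ h, Ω.nuL (G.adornL h) < s) ∧ ∀ i, Ω.oR (G.optL i) < s := by
  cases G with | mk m n l r L R =>
  change (outcome Ω (CGame.mk m n l r L R)).1 < s ↔ (∀ h : m = 0, Ω.nuL (l h) < s) ∧
    ∀ i : Fin m, Ω.oR (L i) < s
  rw [outcome]
  by_cases h : m = 0
  · subst h
    simp
  · rw [dif_neg h]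
    exact (Finset.sup'_lt_iff ⟨⟨0, Nat.pos_of_ne_zero h⟩, Finset.mem_univ _⟩).trans (by simp [h, oR])

theorem lt_oR_iff {G : CGame A} {s : S} :
    s < Ω.oR G ↔ (∀ h, s < Ω.nuR (G.adornR h)) ∧ ∀ i, s < Ω.oL (G.optR i) := by
  cases G with | mk m n l r L R =>
  change s < (outcome Ω (CGame.mk m n l r L R)).2 ↔ (∀ h : n = 0, s < Ω.nuR (r h)) ∧
    ∀ i : Fin n, s < Ω.oL (R i)
  rw [outcome]
  by_cases h : n = 0
  · subst h
    simp
  · rw [dif_neg h]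
    exact (Finset.lt_inf'_iff ⟨⟨0, Nat.pos_of_ne_zero h⟩, Finset.mem_univ _⟩).trans (by simp [h, oL])

theorem oL_le_iff {G : CGame A} {s : S} :
    Ω.oL G ≤ s ↔ (∀ h, Ω.nuL (G.adornL h) ≤ s) ∧ ∀ i, Ω.oR (G.optL i) ≤ s := by
  cases G with | mk m n l r L R =>
  change (outcome Ω (CGame.mk m n l r L R)).1 ≤ s ↔ (∀ h : m = 0, Ω.nuL (l h) ≤ s) ∧
    ∀ i : Fin m, Ω.oR (L i) ≤ s
  rw [outcome]
  by_cases h : m = 0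
  · subst h
    simp
  · rw [dif_neg h]
    exact (Finset.sup'_le_iff ⟨⟨0, Nat.pos_of_ne_zero h⟩, Finset.mem_univ _⟩ _).trans (by simp [h, oR])

theorem le_oR_iff {G : CGame A} {s : S} :
    s ≤ Ω.oR G ↔ (∀ h, s ≤ Ω.nuR (G.adornR h)) ∧ ∀ i, s ≤ Ω.oL (G.optR i) := by
  cases G with | mk m n l r L R =>
  change s ≤ (outcome Ω (CGame.mk m n l r L R)).2 ↔ (∀ h : n = 0, s ≤ Ω.nuR (r h)) ∧
    ∀ i : Fin n, s ≤ Ω.oL (R i)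
  rw [outcome]
  by_cases h : n = 0
  · subst h
    simp
  · rw [dif_neg h]
    exact (Finset.le_inf'_iff ⟨⟨0, Nat.pos_of_ne_zero h⟩, Finset.mem_univ _⟩ _).trans (by simp [h, oL])

section Sum

variable [Add A] {G X : CGame A} {s : S}

theorem oL_add_lt_iff : Ω.oL (G + X) < s ↔
    (∀ h h', Ω.nuL (G.adornL h + X.adornL h') < s) ∧ (∀ i, Ω.oR (G.optL i + X) < s) ∧
      ∀ i, Ω.oR (G + X.optL i) < s := by
  rw [oL_lt_iff, forall_adornL_add (P := fun a => Ω.nuL a < s),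
    forall_optL_add (P := fun K => Ω.oR K < s)]

theorem oL_add_le_iff : Ω.oL (G + X) ≤ s ↔
    (∀ h h', Ω.nuL (G.adornL h + X.adornL h') ≤ s) ∧ (∀ i, Ω.oR (G.optL i + X) ≤ s) ∧
      ∀ i, Ω.oR (G + X.optL i) ≤ s := by
  rw [oL_le_iff, forall_adornL_add (P := fun a => Ω.nuL a ≤ s),
    forall_optL_add (P := fun K => Ω.oR K ≤ s)]

theorem le_oR_add_iff : s ≤ Ω.oR (G + X) ↔
    (∀ h h', s ≤ Ω.nuR (G.adornR h + X.adornR h')) ∧ (∀ i, s ≤ Ω.oL (G.optR i + X)) ∧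
      ∀ i, s ≤ Ω.oL (G + X.optR i) := by
  rw [le_oR_iff, forall_adornR_add (P := fun a => s ≤ Ω.nuR a),
    forall_optR_add (P := fun K => s ≤ Ω.oL K)]

theorem lt_oR_add_iff : s < Ω.oR (G + X) ↔
    (∀ h h', s < Ω.nuR (G.adornR h + X.adornR h')) ∧ (∀ i, s < Ω.oL (G.optR i + X)) ∧
      ∀ i, s < Ω.oL (G + X.optR i) := by
  rw [lt_oR_iff, forall_adornR_add (P := fun a => s < Ω.nuR a),
    forall_optR_add (P := fun K => s < Ω.oL K)]

theorem le_oL_add_iff : s ≤ Ω.oL (G + X) ↔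
    (∃ h h', s ≤ Ω.nuL (G.adornL h + X.adornL h')) ∨ (∃ i, s ≤ Ω.oR (G.optL i + X)) ∨
      ∃ i, s ≤ Ω.oR (G + X.optL i) := by
  rw [← not_lt, oL_add_lt_iff]
  simp only [not_and_or, not_forall, not_lt]

theorem oR_add_lt_iff : Ω.oR (G + X) < s ↔
    (∃ h h', Ω.nuR (G.adornR h + X.adornR h') < s) ∨ (∃ i, Ω.oL (G.optR i + X) < s) ∨
      ∃ i, Ω.oL (G + X.optR i) < s := by
  rw [← not_le, le_oR_add_iff]
  simp only [not_and_or, not_forall, not_le]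

theorem oR_add_le_iff : Ω.oR (G + X) ≤ s ↔
    (∃ h h', Ω.nuR (G.adornR h + X.adornR h') ≤ s) ∨ (∃ i, Ω.oL (G.optR i + X) ≤ s) ∨
      ∃ i, Ω.oL (G + X.optR i) ≤ s := by
  rw [← not_lt, lt_oR_add_iff]
  simp only [not_and_or, not_forall, not_lt]

theorem oR_optL_add_le (i : Fin G.numL) : Ω.oR (G.optL i + X) ≤ Ω.oL (G + X) :=
  (oL_add_le_iff.1 le_rfl).2.1 i

theorem oR_add_optL_le (i : Fin X.numL) : Ω.oR (G + X.optL i) ≤ Ω.oL (G + X) :=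
  (oL_add_le_iff.1 le_rfl).2.2 i

theorem oR_le_oL_optR_add (i : Fin G.numR) : Ω.oR (G + X) ≤ Ω.oL (G.optR i + X) :=
  (le_oR_add_iff.1 le_rfl).2.1 i

theorem oR_le_oL_add_optR (i : Fin X.numR) : Ω.oR (G + X) ≤ Ω.oL (G + X.optR i) :=
  (le_oR_add_iff.1 le_rfl).2.2 i

end Sum

theorem outcome_add_zero {A : Type*} [LinearOrder A] [AddMonoid A] {Ω : GameSpace A S}
    (G : CGame A) :
    Ω.oL (G + pureAtom 0 0) = Ω.oL G ∧ Ω.oR (G + pureAtom 0 0) = Ω.oR G := by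
  induction G using opt_induction with
  | h G ihL ihR =>
    constructor
    · refine eq_of_forall_ge_iff fun s => ?_
      rw [oL_add_le_iff, oL_le_iff]
      refine and_congr ⟨fun h h₁ => ?_, fun h h₁ _ => ?_⟩ ⟨fun h i => ?_, fun h => ⟨fun i => ?_, ?_⟩⟩
      · have := h h₁ rfl
        rwa [show (pureAtom (0 : A) 0).adornL rfl = 0 from rfl, add_zero] at this
      · have := h h₁
        rwa [show (pureAtom (0 : A) 0).adornL _ = 0 from rfl, add_zero]
      · rw [← (ihL i).2]; exact h.1 i
      · rw [(ihL i).2]; exact h i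
      · exact fun i => i.elim0
    · refine eq_of_forall_le_iff fun s => ?_
      rw [le_oR_add_iff, le_oR_iff]
      refine and_congr ⟨fun h h₁ => ?_, fun h h₁ _ => ?_⟩ ⟨fun h i => ?_, fun h => ⟨fun i => ?_, ?_⟩⟩
      · have := h h₁ rfl
        rwa [show (pureAtom (0 : A) 0).adornR rfl = 0 from rfl, add_zero] at this
      · have := h h₁
        rwa [show (pureAtom (0 : A) 0).adornR _ = 0 from rfl, add_zero]
      · rw [← (ihR i).1]; exact h.1 i
      · rw [(ihR i).1]; exact h i
      · exact fun i => i.elim0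

/-- A universe that is parental, dense below and above the result `s₀`, and in which differing
outcomes can be moved to different sides of `s₀`. -/
structure IsAbsolute [Add A] (Ω : GameSpace A S) (U : Set (CGame A)) (s₀ : S) : Prop where
  hereditary : Hereditary U
  parental : Parental U
  exists_oL_lt : ∀ G ∈ U, ∃ W ∈ U, Ω.oL (G + W) < s₀
  exists_le_oR : ∀ G ∈ U, ∃ W ∈ U, s₀ ≤ Ω.oR (G + W)
  separateL : ∀ G H, ∀ X ∈ U, Ω.oL (G + X) < Ω.oL (H + X) →
    ∃ Y ∈ U, Ω.oL (G + Y) < s₀ ∧ s₀ ≤ Ω.oL (H + Y)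
  separateR : ∀ G H, ∀ X ∈ U, Ω.oR (G + X) < Ω.oR (H + X) →
    ∃ Y ∈ U, Ω.oR (G + Y) < s₀ ∧ s₀ ≤ Ω.oR (H + Y)

/-! ### Necessity of the Common Normal Part: separating and linking games. -/

namespace IsAbsolute

variable [Add A] {U : Set (CGame A)} {s₀ : S} {G H : CGame A}

theorem separateL_of_separateR (hU : IsAbsolute Ω U s₀) (hG : G ∈ U) {X : CGame A} (hX : X ∈ U)
    (h₁ : Ω.oR (G + X) < s₀) (h₂ : s₀ ≤ Ω.oR (H + X)) :
    ∃ Y ∈ U, Ω.oL (G + Y) < s₀ ∧ s₀ ≤ Ω.oL (H + Y) := by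
  choose W hW hlt using fun i => hU.exists_oL_lt _ (hU.hereditary.optL G hG i)
  -- The separator is ⟨X | X, W_i⟩. In H Left moves to X; in G that move fails, and Right answers a
  -- move to G^L_i by W_i. The X on Right's side only keeps that side non-empty when G is
  -- left-atomic.
  refine ⟨_, hU.parental 0 G.numL (fun _ => X) (Fin.cons X W) (fun _ => hX)
    (Fin.cases hX hW), oL_add_lt_iff.2 ⟨?_, ?_, ?_⟩, ?_⟩
  · exact fun _ h => absurd h one_ne_zero
  · exact fun i => oR_add_lt_iff.2 (Or.inr (Or.inr ⟨i.succ, hlt i⟩))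
  · exact fun _ => h₁
  · exact le_oL_add_iff.2 (Or.inr (Or.inr ⟨(0 : Fin 1), h₂⟩))

theorem separateR_of_separateL (hU : IsAbsolute Ω U s₀) (hH : H ∈ U) {X : CGame A} (hX : X ∈ U)
    (h₁ : Ω.oL (G + X) < s₀) (h₂ : s₀ ≤ Ω.oL (H + X)) :
    ∃ Y ∈ U, Ω.oR (G + Y) < s₀ ∧ s₀ ≤ Ω.oR (H + Y) := by
  choose W hW hle using fun i => hU.exists_le_oR _ (hU.hereditary.optR H hH i)
  refine ⟨_, hU.parental H.numR 0 (Fin.cons X W) (fun _ => X) (Fin.cases hX hW) (fun _ => hX),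
    ?_, le_oR_add_iff.2 ⟨?_, ?_, ?_⟩⟩
  · exact oR_add_lt_iff.2 (Or.inr (Or.inr ⟨(0 : Fin 1), h₁⟩))
  · exact fun _ h => absurd h one_ne_zero
  · exact fun i => le_oL_add_iff.2 (Or.inr (Or.inr ⟨i.succ, hle i⟩))
  · exact fun _ => h₂

theorem separate_of_not_gameGE (hU : IsAbsolute Ω U s₀) (hG : G ∈ U) (hH : H ∈ U)
    (h : ¬ Ω.GameGE U G H) :
    (∃ Y ∈ U, Ω.oL (G + Y) < s₀ ∧ s₀ ≤ Ω.oL (H + Y)) ∧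
      ∃ Y ∈ U, Ω.oR (G + Y) < s₀ ∧ s₀ ≤ Ω.oR (H + Y) := by
  simp only [GameGE, not_forall, not_and_or, not_le, ge_iff_le] at h
  obtain ⟨X, hX, h | h⟩ := h
  · obtain ⟨Y, hY, h₁, h₂⟩ := hU.separateL G H X hX h
    exact ⟨⟨Y, hY, h₁, h₂⟩, hU.separateR_of_separateL hH hY h₁ h₂⟩
  · obtain ⟨Y, hY, h₁, h₂⟩ := hU.separateR G H X hX h
    exact ⟨hU.separateL_of_separateR hG hY h₁ h₂, ⟨Y, hY, h₁, h₂⟩⟩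

/-- If no `G^L ≽ H` and no `H^R` has `G ≽ H^R`, then `G` is linked to `H`. -/
theorem exists_linked (hU : IsAbsolute Ω U s₀) (hG : G ∈ U) (hH : H ∈ U)
    (h₁ : ∀ i, ¬ Ω.GameGE U (G.optL i) H) (h₂ : ∀ i, ¬ Ω.GameGE U G (H.optR i)) :
    ∃ T ∈ U, Ω.oL (G + T) < s₀ ∧ s₀ ≤ Ω.oR (H + T) := by
  choose X hX hX₁ hX₂ using fun i =>
    (hU.separate_of_not_gameGE (hU.hereditary.optL G hG i) hH (h₁ i)).1
  choose Y hY hY₁ hY₂ using fun i =>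
    (hU.separate_of_not_gameGE hG (hU.hereditary.optR H hH i) (h₂ i)).2
  obtain ⟨V, hV, hV'⟩ := hU.exists_oL_lt G hG
  obtain ⟨W, hW, hW'⟩ := hU.exists_le_oR H hH
  have hZ := hU.parental 0 0 (fun _ => V) (fun _ => V) (fun _ => hV) (fun _ => hV)
  have hZ' := hU.parental 0 0 (fun _ => W) (fun _ => W) (fun _ => hW) (fun _ => hW)
  -- T = ⟨⟨V|V⟩, Y_i | ⟨W|W⟩, X_i⟩. Right answers Left's move to G^L_i by X_i, and Left answers
  -- Right's move to H^R_i by Y_i. The options ⟨V|V⟩ and ⟨W|W⟩ keep both sides non-empty and are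
  -- harmless: the opponent replies to V or W.
  refine ⟨_, hU.parental H.numR G.numL (Fin.cons _ Y) (Fin.cons _ X) (Fin.cases hZ hY)
    (Fin.cases hZ' hX), oL_add_lt_iff.2 ⟨?_, ?_, ?_⟩, le_oR_add_iff.2 ⟨?_, ?_, ?_⟩⟩
  · exact fun _ h => absurd h (Nat.succ_ne_zero _)
  · exact fun i => oR_add_lt_iff.2 (Or.inr (Or.inr ⟨i.succ, hX₁ i⟩))
  · exact Fin.cases (oR_add_lt_iff.2 (Or.inr (Or.inr ⟨(0 : Fin 1), hV'⟩))) hY₁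
  · exact fun _ h => absurd h (Nat.succ_ne_zero _)
  · exact fun i => le_oL_add_iff.2 (Or.inr (Or.inr ⟨i.succ, hY₂ i⟩))
  · exact Fin.cases (le_oL_add_iff.2 (Or.inr (Or.inr ⟨(0 : Fin 1), hW'⟩))) hX₂

theorem commonNormalPart_of_gameGE (hU : IsAbsolute Ω U s₀) (hG : G ∈ U) (hH : H ∈ U)
    (h : Ω.GameGE U G H) : Ω.CommonNormalPart U G H := by
  constructor
  · intro i
    by_contra! hc
    obtain ⟨T, hT, hT₁, hT₂⟩ := hU.exists_linked (hU.hereditary.optR G hG i) hH hc.2 hc.1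
    exact (hT₁.trans_le (hT₂.trans ((h T hT).2.trans (oR_le_oL_optR_add i)))).false
  · intro i
    by_contra! hc
    obtain ⟨T, hT, hT₁, hT₂⟩ := hU.exists_linked hG (hU.hereditary.optL H hH i) hc.1 hc.2
    exact (hT₁.trans_le (hT₂.trans ((oR_optL_add_le i).trans (h T hT).1))).false

end IsAbsolute

/-- A move in H or G is matched by a better option or undone by a reversing reply, and a move in X
is copied. `hL` and `hR` are the positions where the player has no move in either component. -/
theorem gameGE_of_commonNormalPart [Add A] {U : Set (CGame A)} {G H : CGame A}
    (hU : Hereditary U) (h : Ω.CommonNormalPart U G H)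
    (hL : ∀ X ∈ U, ∀ (h₁ : H.LeftAtomic) (h₂ : X.LeftAtomic),
      Ω.nuL (H.adornL h₁ + X.adornL h₂) ≤ Ω.oL (G + X))
    (hR : ∀ X ∈ U, ∀ (h₁ : G.RightAtomic) (h₂ : X.RightAtomic),
      Ω.oR (H + X) ≤ Ω.nuR (G.adornR h₁ + X.adornR h₂)) :
    Ω.GameGE U G H := by
  intro X
  induction X using opt_induction with
  | h X ihL ihR =>
    intro hX
    refine ⟨oL_add_le_iff.2 ⟨hL X hX, fun i => ?_, fun i => ?_⟩,
      le_oR_add_iff.2 ⟨hR X hX, fun i => ?_, fun i => ?_⟩⟩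
    · rcases h.2 i with ⟨j, hj⟩ | ⟨j, hj⟩
      · exact (hj X hX).2.trans (oR_optL_add_le j)
      · exact (oR_le_oL_optR_add j).trans (hj X hX).1
    · exact (ihL i (hU.optL X hX i)).2.trans (oR_add_optL_le i)
    · rcases h.1 i with ⟨j, hj⟩ | ⟨j, hj⟩
      · exact (oR_le_oL_optR_add j).trans (hj X hX).1
      · exact (hj X hX).2.trans (oR_optL_add_le j)
    · exact (oR_le_oL_add_optR i).trans (ihR i (hU.optR X hX i)).1

/-! ### Normal and misère play. -/

section WinLoss

/-- With two results every strict inequality straddles `1`, so separation holds with the test game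
itself. -/
theorem units_lt_iff {a b : ℤˣ} : a < b → a < 1 ∧ 1 ≤ b := by
  revert a b; decide

theorem units_neg_one_le (a : ℤˣ) : -1 ≤ a := by
  revert a; decide

theorem units_le_one (a : ℤˣ) : a ≤ 1 := by
  revert a; decide

theorem isAbsolute_of_dense {A : Type*} [LinearOrder A] [Add A] {Ω : GameSpace A ℤˣ}
    {U : Set (CGame A)} (h₁ : Hereditary U) (h₂ : Parental U)
    (h₃ : ∀ G ∈ U, ∃ W ∈ U, Ω.oL (G + W) < 1) (h₄ : ∀ G ∈ U, ∃ W ∈ U, 1 ≤ Ω.oR (G + W)) :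
    IsAbsolute Ω U 1 :=
  ⟨h₁, h₂, h₃, h₄, fun _ _ X hX h => ⟨X, hX, units_lt_iff h⟩,
    fun _ _ X hX h => ⟨X, hX, units_lt_iff h⟩⟩

theorem isAbsolute_normalPlay : IsAbsolute normalPlay Set.univ 1 := by
  refine isAbsolute_of_dense hereditary_univ parental_univ (fun G _ => ?_) (fun G _ => ?_)
  · induction G using opt_induction with
    | h G ihL _ =>
      choose W _ hW using fun i => ihL i trivial
      -- Left has no move in ⟨∅ | W_i⟩ and loses when stuck; a move to G^L_i is answered by W_i.
      refine ⟨CGame.mk 0 G.numL (fun _ => ()) (fun _ => ()) Fin.elim0 W, trivial,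
        oL_add_lt_iff.2 ⟨fun _ _ => show (-1 : ℤˣ) < 1 by decide, fun i => ?_, fun i => i.elim0⟩⟩
      exact oR_add_lt_iff.2 (Or.inr (Or.inr ⟨i, hW i⟩))
  · induction G using opt_induction with
    | h G _ ihR =>
      choose W _ hW using fun i => ihR i trivial
      refine ⟨CGame.mk G.numR 0 (fun _ => ()) (fun _ => ()) W Fin.elim0, trivial,
        le_oR_add_iff.2 ⟨fun _ _ => le_refl (1 : ℤˣ), fun i => ?_, fun i => i.elim0⟩⟩
      exact le_oL_add_iff.2 (Or.inr (Or.inr ⟨i, hW i⟩))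

theorem isAbsolute_misere {U : Set (CGame Unit)} (hU : Hereditary U) (hU' : Parental U)
    (h0 : pureAtom 0 0 ∈ U) : IsAbsolute misere U 1 := by
  refine isAbsolute_of_dense hU hU' (fun G hG => ?_) (fun G hG => ?_)
  · induction G using opt_induction with
    | h G ihL ihR =>
      choose W hW hlt using fun i => ihL i (hU.optL G hG i)
      -- A stuck Left would win here, and `U` need not contain one-sided games, so Left also gets an
      -- option Z, chosen so that Right wins G + Z moving first: by being stuck at once if G is
      -- right-atomic, otherwise by moving to some G^R.
      obtain ⟨Z, hZ, hlt'⟩ : ∃ Z ∈ U, misere.oR (G + Z) < 1 := by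
        by_cases h : G.RightAtomic
        · exact ⟨_, h0, oR_add_lt_iff.2 (Or.inl ⟨h, rfl, show (-1 : ℤˣ) < 1 by decide⟩)⟩
        · obtain ⟨i⟩ := exists_optR h
          obtain ⟨V, hV, hV'⟩ := ihR i (hU.optR G hG i)
          exact ⟨V, hV, (oR_le_oL_optR_add i).trans_lt hV'⟩
      refine ⟨_, hU' 0 G.numL (fun _ => Z) (Fin.cons Z W) (fun _ => hZ) (Fin.cases hZ hW),
        oL_add_lt_iff.2 ⟨fun _ h => absurd h one_ne_zero, fun i => ?_, fun _ => hlt'⟩⟩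
      exact oR_add_lt_iff.2 (Or.inr (Or.inr ⟨i.succ, hlt i⟩))
  · induction G using opt_induction with
    | h G ihL ihR =>
      choose W hW hle using fun i => ihR i (hU.optR G hG i)
      obtain ⟨Z, hZ, hle'⟩ : ∃ Z ∈ U, 1 ≤ misere.oL (G + Z) := by
        by_cases h : G.LeftAtomic
        · exact ⟨_, h0, le_oL_add_iff.2 (Or.inl ⟨h, rfl, le_refl (1 : ℤˣ)⟩)⟩
        · obtain ⟨i⟩ := exists_optL h
          obtain ⟨V, hV, hV'⟩ := ihL i (hU.optL G hG i)
          exact ⟨V, hV, hV'.trans (oR_optL_add_le i)⟩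
      refine ⟨_, hU' G.numR 0 (Fin.cons Z W) (fun _ => Z) (Fin.cases hZ hW) (fun _ => hZ),
        le_oR_add_iff.2 ⟨fun _ h => absurd h one_ne_zero, fun i => ?_, fun _ => hle'⟩⟩
      exact le_oL_add_iff.2 (Or.inr (Or.inr ⟨i.succ, hle i⟩))

theorem leftAtomic_of_gameGE_misere {G H : CGame Unit} (h : misere.GameGE Set.univ G H)
    (hH : H.LeftAtomic) : G.LeftAtomic := by
  by_contra hG
  have hU := isAbsolute_misere hereditary_univ parental_univ trivial
  choose W _ hW using fun i => hU.exists_oL_lt (G.optL i) trivial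
  -- In ⟨∅ | W_i⟩ Left is forced to move in G and Right answers by W_i, whereas with the left-atomic
  -- H Left is stuck and wins.
  have h' := (h (CGame.mk 0 G.numL (fun _ => ()) (fun _ => ()) Fin.elim0 W) trivial).1
  have h₁ : misere.oL (G + CGame.mk 0 G.numL (fun _ => ()) (fun _ => ()) Fin.elim0 W) < 1 :=
    oL_add_lt_iff.2 ⟨fun h => absurd h hG,
      fun i => oR_add_lt_iff.2 (Or.inr (Or.inr ⟨i, hW i⟩)), fun i => i.elim0⟩
  have h₂ : 1 ≤ misere.oL (H + CGame.mk 0 G.numL (fun _ => ()) (fun _ => ()) Fin.elim0 W) :=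
    le_oL_add_iff.2 (Or.inl ⟨hH, rfl, le_refl (1 : ℤˣ)⟩)
  exact (h₁.trans_le (h₂.trans h')).false

theorem rightAtomic_of_gameGE_misere {G H : CGame Unit} (h : misere.GameGE Set.univ G H)
    (hG : G.RightAtomic) : H.RightAtomic := by
  by_contra hH
  have hU := isAbsolute_misere hereditary_univ parental_univ trivial
  choose W _ hW using fun i => hU.exists_le_oR (H.optR i) trivial
  have h' := (h (CGame.mk H.numR 0 (fun _ => ()) (fun _ => ()) W Fin.elim0) trivial).2
  have h₁ : misere.oR (G + CGame.mk H.numR 0 (fun _ => ()) (fun _ => ()) W Fin.elim0) < 1 :=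
    oR_add_lt_iff.2 (Or.inl ⟨hG, rfl, show (-1 : ℤˣ) < 1 by decide⟩)
  have h₂ : 1 ≤ misere.oR (H + CGame.mk H.numR 0 (fun _ => ()) (fun _ => ()) W Fin.elim0) :=
    le_oR_add_iff.2 ⟨fun h => absurd h hH,
      fun i => le_oL_add_iff.2 (Or.inr (Or.inr ⟨i, hW i⟩)), fun i => i.elim0⟩
  exact (h₁.trans_le (h₂.trans h')).false

theorem gameGE_normalPlay_iff (G H : CGame Unit) :
    normalPlay.GameGE Set.univ G H ↔ normalPlay.CommonNormalPart Set.univ G H :=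
  ⟨isAbsolute_normalPlay.commonNormalPart_of_gameGE trivial trivial, fun h =>
    gameGE_of_commonNormalPart hereditary_univ h (fun _ _ _ _ => units_neg_one_le _)
      (fun _ _ _ _ => units_le_one _)⟩

theorem gameGE_misere_univ_iff (G H : CGame Unit) :
    misere.GameGE Set.univ G H ↔ misere.CommonNormalPart Set.univ G H ∧
      (H.LeftAtomic → G.LeftAtomic) ∧ (G.RightAtomic → H.RightAtomic) := by
  have hU := isAbsolute_misere hereditary_univ parental_univ trivial
  refine ⟨fun h => ⟨hU.commonNormalPart_of_gameGE trivial trivial h,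
    leftAtomic_of_gameGE_misere h, rightAtomic_of_gameGE_misere h⟩, fun ⟨h, hL, hR⟩ =>
    gameGE_of_commonNormalPart hereditary_univ h (fun X _ h₁ h₂ => ?_) (fun X _ h₁ h₂ => ?_)⟩
  · exact le_oL_add_iff.2 (Or.inl ⟨hL h₁, h₂, le_rfl⟩)
  · exact oR_add_le_iff.2 (Or.inl ⟨hR h₁, h₂, le_rfl⟩)

theorem outcomeGE_of_gameGE {A : Type*} [LinearOrder A] [AddMonoid A] {Ω : GameSpace A S}
    {U : Set (CGame A)} {G H : CGame A} (h0 : pureAtom 0 0 ∈ U) (h : Ω.GameGE U G H) :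
    Ω.OutcomeGE G H := by
  have := h _ h0
  rwa [(outcome_add_zero G).1, (outcome_add_zero G).2, (outcome_add_zero H).1,
    (outcome_add_zero H).2] at this

theorem gameGE_misere_isDicot_iff (G H : CGame Unit) (hG : IsDicot G) (hH : IsDicot H) :
    misere.GameGE {X | IsDicot X} G H ↔
      misere.CommonNormalPart {X | IsDicot X} G H ∧ misere.OutcomeGE G H := by
  have h0 : (pureAtom 0 0 : CGame Unit) ∈ {X : CGame Unit | IsDicot X} := isDicot_pureAtom 0
  have hU := isAbsolute_misere hereditary_isDicot parental_isDicot h0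
  refine ⟨fun h => ⟨hU.commonNormalPart_of_gameGE hG hH h, outcomeGE_of_gameGE h0 h⟩,
    fun ⟨h, hL, hR⟩ => gameGE_of_commonNormalPart hereditary_isDicot h
      (fun X hX h₁ h₂ => ?_) (fun X hX h₁ h₂ => ?_)⟩
  · obtain ⟨a, rfl⟩ := IsDicot.eq_pureAtom_of_leftAtomic hX h₂
    -- `Unit` has one adorn, so the pure atom is the zero game.
    exact ((oL_le_iff.1 le_rfl).1 h₁).trans (hL.trans (outcome_add_zero G).1.ge)
  · obtain ⟨a, rfl⟩ := IsDicot.eq_pureAtom_of_leftAtomic hX ((isDicot_iff.1 hX).1.2 h₂)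
    exact ((outcome_add_zero H).2.le.trans hR).trans ((le_oR_iff.1 le_rfl).1 h₁)

end WinLoss

end GameSpace

/-! ### Scoring play: outcomes and adorns. -/

namespace GameSpace

open CGame

variable {A S : Type*} [LinearOrder A] [LinearOrder S] {ν : A → S} {hν : StrictMono ν}

section Order

theorem le_outcome_of_forall_isAdorn {G : CGame A} {s : S} (h : ∀ a, IsAdorn a G → s ≤ ν a) :
    s ≤ (scoringPlay ν hν).oL G ∧ s ≤ (scoringPlay ν hν).oR G := by
  induction G using opt_induction with
  | h G ihL ihR =>
    constructor
    · by_cases hG : G.LeftAtomic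
      · exact (h _ (isAdorn_iff.2 (Or.inl ⟨hG, rfl⟩))).trans
          ((oL_le_iff (Ω := scoringPlay ν hν).1 le_rfl).1 hG)
      · obtain ⟨i⟩ := exists_optL hG
        exact (ihL i fun a ha => h a (isAdorn_iff.2 (Or.inr (Or.inr (Or.inl ⟨i, ha⟩))))).2.trans
          ((oL_le_iff.1 le_rfl).2 i)
    · exact le_oR_iff.2 ⟨fun hG => h _ (isAdorn_iff.2 (Or.inr (Or.inl ⟨hG, rfl⟩))), fun i =>
        (ihR i fun a ha => h a (isAdorn_iff.2 (Or.inr (Or.inr (Or.inr ⟨i, ha⟩))))).1⟩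

theorem outcome_le_of_forall_isAdorn {G : CGame A} {s : S} (h : ∀ a, IsAdorn a G → ν a ≤ s) :
    (scoringPlay ν hν).oL G ≤ s ∧ (scoringPlay ν hν).oR G ≤ s := by
  induction G using opt_induction with
  | h G ihL ihR =>
    constructor
    · exact oL_le_iff.2 ⟨fun hG => h _ (isAdorn_iff.2 (Or.inl ⟨hG, rfl⟩)), fun i =>
        (ihL i fun a ha => h a (isAdorn_iff.2 (Or.inr (Or.inr (Or.inl ⟨i, ha⟩))))).2⟩
    · by_cases hG : G.RightAtomic
      · exact ((le_oR_iff.1 le_rfl).1 hG).trans (h _ (isAdorn_iff.2 (Or.inr (Or.inl ⟨hG, rfl⟩))))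
      · obtain ⟨i⟩ := exists_optR hG
        exact ((le_oR_iff.1 le_rfl).2 i).trans
          (ihR i fun a ha => h a (isAdorn_iff.2 (Or.inr (Or.inr (Or.inr ⟨i, ha⟩))))).1

/-- Maxima and minima over finite lists are attained. `S` carries no addition, so outcomes must be
traced back to adorns before they can be translated. -/
theorem exists_isAdorn_outcome_eq (G : CGame A) :
    (∃ a, IsAdorn a G ∧ (scoringPlay ν hν).oL G = ν a) ∧
      ∃ a, IsAdorn a G ∧ (scoringPlay ν hν).oR G = ν a := by
  induction G using opt_induction with
  | h G ihL ihR =>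
    constructor
    · by_contra! hc
      refine lt_irrefl ((scoringPlay ν hν).oL G) (oL_lt_iff.2 ⟨fun h => ?_, fun i => ?_⟩)
      · exact lt_of_le_of_ne ((oL_le_iff.1 le_rfl).1 h)
          (hc _ (isAdorn_iff.2 (Or.inl ⟨h, rfl⟩))).symm
      · obtain ⟨a, ha, h⟩ := (ihL i).2
        refine lt_of_le_of_ne ((oL_le_iff.1 le_rfl).2 i) (h.trans_ne ?_)
        exact (hc a (isAdorn_iff.2 (Or.inr (Or.inr (Or.inl ⟨i, ha⟩))))).symm
    · by_contra! hc
      refine lt_irrefl ((scoringPlay ν hν).oR G) (lt_oR_iff.2 ⟨fun h => ?_, fun i => ?_⟩)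
      · exact lt_of_le_of_ne ((le_oR_iff.1 le_rfl).1 h)
          (hc _ (isAdorn_iff.2 (Or.inr (Or.inl ⟨h, rfl⟩))))
      · obtain ⟨a, ha, h⟩ := (ihR i).1
        refine lt_of_le_of_ne ((le_oR_iff.1 le_rfl).2 i) fun h' => ?_
        exact hc a (isAdorn_iff.2 (Or.inr (Or.inr (Or.inr ⟨i, ha⟩)))) (h'.trans h)

end Order

/-! ### Pass-allowed outcomes. -/

variable [AddCommGroup A]

/-- Integers contribute only the adorn `0`, so each of these outcomes is the value of one of the
finitely many adorns of `G`. -/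
theorem finite_range_oL_add_rightMoves (G : CGame A) :
    (Set.range fun k : ℕ => (scoringPlay ν hν).oL (G + rightMoves k)).Finite := by
  refine ((finite_isAdorn G).image ν).subset ?_
  rintro _ ⟨k, rfl⟩
  obtain ⟨s, hs, h⟩ := (exists_isAdorn_outcome_eq (hν := hν) (G + rightMoves k)).1
  obtain ⟨a, b, ha, hb, rfl⟩ := exists_of_isAdorn_add _ hs
  rw [eq_zero_of_isAdorn_rightMoves hb, add_zero] at h
  exact ⟨a, ha, h.symm⟩

theorem finite_range_oR_add_leftMoves (G : CGame A) :
    (Set.range fun k : ℕ => (scoringPlay ν hν).oR (G + leftMoves k)).Finite := by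
  refine ((finite_isAdorn G).image ν).subset ?_
  rintro _ ⟨k, rfl⟩
  obtain ⟨s, hs, h⟩ := (exists_isAdorn_outcome_eq (hν := hν) (G + leftMoves k)).2
  obtain ⟨a, b, ha, hb, rfl⟩ := exists_of_isAdorn_add _ hs
  rw [eq_zero_of_isAdorn_leftMoves hb, add_zero] at h
  exact ⟨a, ha, h.symm⟩

theorem exists_isPassAllowedL (G : CGame A) : ∃ s, (scoringPlay ν hν).IsPassAllowedL G s := by
  obtain ⟨s, hs⟩ := (finite_range_oL_add_rightMoves (hν := hν) G).exists_minimal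
    (Set.range_nonempty _)
  exact ⟨s, hs.1, fun t ht => (le_total s t).elim id (hs.2 ht)⟩

theorem exists_isPassAllowedR (G : CGame A) : ∃ s, (scoringPlay ν hν).IsPassAllowedR G s := by
  obtain ⟨s, hs⟩ := (finite_range_oR_add_leftMoves (hν := hν) G).exists_maximal
    (Set.range_nonempty _)
  exact ⟨s, hs.1, fun t ht => (le_total t s).elim id (hs.2 ht)⟩

theorem isPassAllowedL_of_leftAtomic {G : CGame A} {s : S} (h : G.LeftAtomic)
    (hs : (scoringPlay ν hν).IsPassAllowedL G s) : ν (G.adornL h) ≤ s := by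
  obtain ⟨k, rfl⟩ := hs.1
  refine le_oL_add_iff.2 (Or.inl ⟨h, rightMoves_leftAtomic k, ?_⟩)
  rw [eq_zero_of_isAdorn_rightMoves (isAdorn_iff.2 (Or.inl ⟨rightMoves_leftAtomic k, rfl⟩)),
    add_zero]
  rfl

theorem isPassAllowedR_of_rightAtomic {G : CGame A} {s : S} (h : G.RightAtomic)
    (hs : (scoringPlay ν hν).IsPassAllowedR G s) : s ≤ ν (G.adornR h) := by
  obtain ⟨k, rfl⟩ := hs.1
  refine oR_add_le_iff.2 (Or.inl ⟨h, leftMoves_rightAtomic k, ?_⟩)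
  rw [eq_zero_of_isAdorn_leftMoves
    (isAdorn_iff.2 (Or.inr (Or.inl ⟨leftMoves_rightAtomic k, rfl⟩))), add_zero]
  rfl

theorem isPassAllowed_le_of_gameGE {G H : CGame A} {gL hL gR hR : S}
    (h₁ : (scoringPlay ν hν).IsPassAllowedL G gL) (h₂ : (scoringPlay ν hν).IsPassAllowedL H hL)
    (h₃ : (scoringPlay ν hν).IsPassAllowedR G gR) (h₄ : (scoringPlay ν hν).IsPassAllowedR H hR)
    (h : (scoringPlay ν hν).GameGE {X | IsGuaranteed X} G H) : hL ≤ gL ∧ hR ≤ gR := by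
  obtain ⟨k, rfl⟩ := h₁.1
  obtain ⟨k', rfl⟩ := h₄.1
  exact ⟨(h₂.2 ⟨k, rfl⟩).trans (h _ (isGuaranteed_rightMoves k)).1,
    (h _ (isGuaranteed_leftMoves k')).2.trans (h₃.2 ⟨k', rfl⟩)⟩

/-! ### Translation of outcomes, and the two scoring universes. -/

variable [IsOrderedAddMonoid A]

/-- Translation by `c` makes sense only on the image of `ν`, hence the formulation through
thresholds `ν a`. -/
theorem le_outcome_add_shift_iff (c a : A) (G X : CGame A) :
    (ν (a + c) ≤ (scoringPlay ν hν).oL (G + shift c X) ↔ ν a ≤ (scoringPlay ν hν).oL (G + X)) ∧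
      (ν (a + c) ≤ (scoringPlay ν hν).oR (G + shift c X) ↔
        ν a ≤ (scoringPlay ν hν).oR (G + X)) := by
  induction G using opt_induction generalizing X with
  | h G ihL ihR =>
  induction X with
  | mk m n l r L R ihL' ihR' =>
    constructor
    · rw [le_oL_add_iff, le_oL_add_iff]
      refine or_congr (exists_congr fun h => exists_congr fun h' => ?_)
        (or_congr (exists_congr fun i => (ihL i _).2) (exists_congr fun i => (ihL' i).2))
      change ν (a + c) ≤ ν (G.adornL h + (l h' + c)) ↔ ν a ≤ ν (G.adornL h + l h')
      rw [hν.le_iff_le, hν.le_iff_le, ← add_assoc, add_le_add_iff_right]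
    · rw [le_oR_add_iff, le_oR_add_iff]
      refine and_congr (forall_congr' fun h => forall_congr' fun h' => ?_)
        (and_congr (forall_congr' fun i => (ihR i _).1) (forall_congr' fun i => (ihR' i).1))
      change ν (a + c) ≤ ν (G.adornR h + (r h' + c)) ↔ ν a ≤ ν (G.adornR h + r h')
      rw [hν.le_iff_le, hν.le_iff_le, ← add_assoc, add_le_add_iff_right]

theorem le_outcome_add_pureAtom_iff (c a : A) (G : CGame A) :
    (ν (a + c) ≤ (scoringPlay ν hν).oL (G + pureAtom c c) ↔ ν a ≤ (scoringPlay ν hν).oL G) ∧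
      (ν (a + c) ≤ (scoringPlay ν hν).oR (G + pureAtom c c) ↔
        ν a ≤ (scoringPlay ν hν).oR G) := by
  have := le_outcome_add_shift_iff (hν := hν) c a G (pureAtom 0 0)
  rwa [shift_pureAtom_zero, (outcome_add_zero G).1, (outcome_add_zero G).2] at this

theorem isAbsolute_scoringPlay [Nontrivial A] {U : Set (CGame A)} (h₁ : Hereditary U)
    (h₂ : Parental U) (h₃ : ∀ a, pureAtom a a ∈ U) (h₄ : ∀ c, ∀ X ∈ U, shift c X ∈ U) :
    IsAbsolute (scoringPlay ν hν) U (ν 0) := by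
  refine ⟨h₁, h₂, fun G _ => ?_, fun G _ => ?_, fun G H X hX h => ?_, fun G H X hX h => ?_⟩
  · obtain ⟨b, hb⟩ := (finite_isAdorn G).bddAbove
    obtain ⟨c, hc⟩ := exists_gt b
    refine ⟨_, h₃ (-c), (outcome_le_of_forall_isAdorn (s := ν (b + -c)) fun s hs => ?_).1.trans_lt
      (hν (by simpa using hc))⟩
    obtain ⟨x, y, hx, hy, rfl⟩ := exists_of_isAdorn_add _ hs
    rw [eq_of_isAdorn_pureAtom hy]
    exact hν.monotone (add_le_add_left (hb hx) _)
  · obtain ⟨b, hb⟩ := (finite_isAdorn G).bddBelow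
    refine ⟨_, h₃ (-b), (le_outcome_of_forall_isAdorn fun s hs => ?_).2⟩
    obtain ⟨x, y, hx, hy, rfl⟩ := exists_of_isAdorn_add _ hs
    rw [eq_of_isAdorn_pureAtom hy]
    exact hν.monotone (by simpa using hb hx)
  · obtain ⟨b, _, hb⟩ := (exists_isAdorn_outcome_eq (hν := hν) (H + X)).1
    -- Shifting by -b brings the larger outcome ν b exactly to the threshold ν 0.
    refine ⟨_, h₄ (-b) X hX, ?_⟩
    rw [← not_le, ← add_neg_cancel b, (le_outcome_add_shift_iff _ _ _ _).1,
      (le_outcome_add_shift_iff _ _ _ _).1, not_le, ← hb]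
    exact ⟨h, le_rfl⟩
  · obtain ⟨b, _, hb⟩ := (exists_isAdorn_outcome_eq (hν := hν) (H + X)).2
    refine ⟨_, h₄ (-b) X hX, ?_⟩
    rw [← not_le, ← add_neg_cancel b, (le_outcome_add_shift_iff _ _ _ _).2,
      (le_outcome_add_shift_iff _ _ _ _).2, not_le, ← hb]
    exact ⟨h, le_rfl⟩

theorem gameGE_scoringPlay_isDicot_iff [Nontrivial A] (G H : CGame A) (hG : IsDicot G)
    (hH : IsDicot H) :
    (scoringPlay ν hν).GameGE {X | IsDicot X} G H ↔
      (scoringPlay ν hν).CommonNormalPart {X | IsDicot X} G H ∧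
        (scoringPlay ν hν).OutcomeGE G H := by
  have hU : IsAbsolute (scoringPlay ν hν) {X | IsDicot X} (ν 0) :=
    isAbsolute_scoringPlay hereditary_isDicot parental_isDicot isDicot_pureAtom
      fun c _ hX => hX.shift c
  refine ⟨fun h => ⟨hU.commonNormalPart_of_gameGE hG hH h,
    outcomeGE_of_gameGE (isDicot_pureAtom 0) h⟩,
    fun ⟨h, hL, hR⟩ => gameGE_of_commonNormalPart hereditary_isDicot h
      (fun X hX h₁ h₂ => ?_) (fun X hX h₁ h₂ => ?_)⟩
  · obtain ⟨a, rfl⟩ := IsDicot.eq_pureAtom_of_leftAtomic hX h₂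
    exact (le_outcome_add_pureAtom_iff a _ G).1.2 (((oL_le_iff.1 le_rfl).1 h₁).trans hL)
  · obtain ⟨a, rfl⟩ := IsDicot.eq_pureAtom_of_leftAtomic hX ((isDicot_iff.1 hX).1.2 h₂)
    -- The translation lemma only gives lower bounds on outcomes, so the outcome to be bounded above
    -- is first written as ν b.
    obtain ⟨b, _, hb⟩ := (exists_isAdorn_outcome_eq (hν := hν) (H + pureAtom a a)).2
    have h₃ := (le_outcome_add_pureAtom_iff (hν := hν) a (b - a) H).2.1
      (by rw [sub_add_cancel, hb])
    have h₄ := hν.le_iff_le.1 ((h₃.trans hR).trans ((le_oR_iff.1 le_rfl).1 h₁))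
    rw [hb]
    exact hν.monotone (sub_le_iff_le_add.1 h₄)

/-- Replacing enough consecutive moves for Right by a game with adorns at least `b` raises the
result by at least `b`. -/
theorem le_outcome_add_of_le_outcome_add_rightMoves {G X : CGame A} {a b : A} {k : ℕ}
    (hG : IsGuaranteed G) (hX : ∀ s, IsAdorn s X → b ≤ s) (hk : X.height ≤ k) :
    (ν a ≤ (scoringPlay ν hν).oL (G + rightMoves k) → ν (a + b) ≤ (scoringPlay ν hν).oL (G + X)) ∧
      (ν a ≤ (scoringPlay ν hν).oR (G + rightMoves k) →
        ν (a + b) ≤ (scoringPlay ν hν).oR (G + X)) := by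
  induction G using opt_induction generalizing X k with
  | h G ihL ihR =>
  induction X using opt_induction generalizing k with
  | h X _ ihR' =>
    obtain ⟨hG₁, hG₂, hG₃, hG₄⟩ := isGuaranteed_iff.1 hG
    constructor
    · intro h
      -- Left keeps to the moves in G that work against the passes. Once Left is stuck in G, the
      -- guarantee makes every adorn of G at least a, so whatever follows scores at least a + b.
      rcases le_oL_add_iff.1 h with ⟨h₁, h₂, h₃⟩ | ⟨i, hi⟩ | ⟨i, -⟩
      · rw [eq_zero_of_isAdorn_rightMoves (isAdorn_iff.2 (Or.inl ⟨h₂, rfl⟩)), add_zero] at h₃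
        refine (le_outcome_of_forall_isAdorn fun s hs => ?_).1
        obtain ⟨x, y, hx, hy, rfl⟩ := exists_of_isAdorn_add _ hs
        exact hν.monotone (add_le_add ((hν.le_iff_le.1 h₃).trans (hG₁ h₁ x hx)) (hX y hy))
      · exact ((ihL i (hG₃ i) hX hk).2 hi).trans (oR_optL_add_le i)
      · exact absurd (rightMoves_leftAtomic k) (not_leftAtomic_of_opt i)
    · intro h
      refine le_oR_add_iff.2 ⟨fun h₁ h₂ => ?_, fun i => ?_, fun i => ?_⟩
      · have h₃ : (scoringPlay ν hν).oR (G + rightMoves k) ≤ ν (G.adornR h₁) := by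
          refine (outcome_le_of_forall_isAdorn fun s hs => ?_).2
          obtain ⟨x, y, hx, hy, rfl⟩ := exists_of_isAdorn_add _ hs
          rw [eq_zero_of_isAdorn_rightMoves hy, add_zero]
          exact hν.monotone (hG₂ h₁ x hx)
        exact hν.monotone (add_le_add (hν.le_iff_le.1 (h.trans h₃))
          (hX _ (isAdorn_iff.2 (Or.inr (Or.inl ⟨h₂, rfl⟩)))))
      · exact (ihR i (hG₄ i) hX hk).1 (h.trans (oR_le_oL_optR_add i))
      · have hlt := (height_optR_lt X i).trans_le hk
        -- A Right move in X is matched with one pass; the height bound ensures that a pass is left.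
        obtain ⟨k, rfl⟩ : ∃ k', k = k' + 1 := ⟨k - 1, by omega⟩
        exact (ihR' i (fun s hs => hX s (isAdorn_iff.2 (Or.inr (Or.inr (Or.inr ⟨i, hs⟩)))))
          (Nat.lt_succ_iff.1 hlt)).1
          (h.trans (oR_le_oL_add_optR (X := rightMoves (k + 1)) (0 : Fin 1)))

/-- Replacing enough consecutive moves for Left by a game with adorns at most `b` raises the
result by at most `b`. -/
theorem outcome_add_le_of_outcome_add_leftMoves_le {G X : CGame A} {a b : A} {k : ℕ}
    (hG : IsGuaranteed G) (hX : ∀ s, IsAdorn s X → s ≤ b) (hk : X.height ≤ k) :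
    ((scoringPlay ν hν).oL (G + leftMoves k) ≤ ν a → (scoringPlay ν hν).oL (G + X) ≤ ν (a + b)) ∧
      ((scoringPlay ν hν).oR (G + leftMoves k) ≤ ν a →
        (scoringPlay ν hν).oR (G + X) ≤ ν (a + b)) := by
  induction G using opt_induction generalizing X k with
  | h G ihL ihR =>
  induction X using opt_induction generalizing k with
  | h X ihL' _ =>
    obtain ⟨hG₁, hG₂, hG₃, hG₄⟩ := isGuaranteed_iff.1 hG
    constructor
    · intro h
      refine oL_add_le_iff.2 ⟨fun h₁ h₂ => ?_, fun i => ?_, fun i => ?_⟩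
      · have h₃ : ν (G.adornL h₁) ≤ (scoringPlay ν hν).oL (G + leftMoves k) := by
          refine (le_outcome_of_forall_isAdorn fun s hs => ?_).1
          obtain ⟨x, y, hx, hy, rfl⟩ := exists_of_isAdorn_add _ hs
          rw [eq_zero_of_isAdorn_leftMoves hy, add_zero]
          exact hν.monotone (hG₁ h₁ x hx)
        exact hν.monotone (add_le_add (hν.le_iff_le.1 (h₃.trans h))
          (hX _ (isAdorn_iff.2 (Or.inl ⟨h₂, rfl⟩))))
      · exact (ihL i (hG₃ i) hX hk).2 ((oR_optL_add_le i).trans h)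
      · have hlt := (height_optL_lt X i).trans_le hk
        obtain ⟨k, rfl⟩ : ∃ k', k = k' + 1 := ⟨k - 1, by omega⟩
        exact (ihL' i (fun s hs => hX s (isAdorn_iff.2 (Or.inr (Or.inr (Or.inl ⟨i, hs⟩)))))
          (Nat.lt_succ_iff.1 hlt)).2
          ((oR_add_optL_le (X := leftMoves (k + 1)) (0 : Fin 1)).trans h)
    · intro h
      rcases oR_add_le_iff.1 h with ⟨h₁, h₂, h₃⟩ | ⟨i, hi⟩ | ⟨i, -⟩
      · rw [eq_zero_of_isAdorn_leftMoves (isAdorn_iff.2 (Or.inr (Or.inl ⟨h₂, rfl⟩))),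
          add_zero] at h₃
        refine (outcome_le_of_forall_isAdorn fun s hs => ?_).2
        obtain ⟨x, y, hx, hy, rfl⟩ := exists_of_isAdorn_add _ hs
        exact hν.monotone (add_le_add ((hG₂ h₁ x hx).trans (hν.le_iff_le.1 h₃)) (hX y hy))
      · exact (oR_le_oL_optR_add i).trans ((ihR i (hG₄ i) hX hk).1 hi)
      · exact absurd (leftMoves_rightAtomic k) (not_rightAtomic_of_opt i)

theorem gameGE_isGuaranteed_iff [Nontrivial A] {G H : CGame A} (hG : IsGuaranteed G)
    (hH : IsGuaranteed H) {gL hL gR hR : S}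
    (h₁ : (scoringPlay ν hν).IsPassAllowedL G gL) (h₂ : (scoringPlay ν hν).IsPassAllowedL H hL)
    (h₃ : (scoringPlay ν hν).IsPassAllowedR G gR) (h₄ : (scoringPlay ν hν).IsPassAllowedR H hR) :
    (scoringPlay ν hν).GameGE {X | IsGuaranteed X} G H ↔
      (scoringPlay ν hν).CommonNormalPart {X | IsGuaranteed X} G H ∧ gL ≥ hL ∧ gR ≥ hR := by
  have hU : IsAbsolute (scoringPlay ν hν) {X | IsGuaranteed X} (ν 0) :=
    isAbsolute_scoringPlay hereditary_isGuaranteed parental_isGuaranteed isGuaranteed_pureAtom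
      fun c _ hX => hX.shift c
  refine ⟨fun h => ⟨hU.commonNormalPart_of_gameGE hG hH h, isPassAllowed_le_of_gameGE h₁ h₂ h₃ h₄ h⟩,
    fun ⟨h, h₅, h₆⟩ => gameGE_of_commonNormalPart hereditary_isGuaranteed h
      (fun X hX hH' hX' => ?_) (fun X hX hG' hX' => ?_)⟩
  · refine (le_outcome_add_of_le_outcome_add_rightMoves hG ((isGuaranteed_iff.1 hX).1 hX')
      le_rfl).1 ?_
    exact ((isPassAllowedL_of_leftAtomic hH' h₂).trans h₅).trans (h₁.2 ⟨X.height, rfl⟩)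
  · refine (outcome_add_le_of_outcome_add_leftMoves_le hH ((isGuaranteed_iff.1 hX).2.1 hX')
      le_rfl).2 ?_
    exact (h₄.2 ⟨X.height, rfl⟩).trans (h₆.trans (isPassAllowedR_of_rightAtomic hG' h₃))

end GameSpace

theorem mainTheorem6 {A S : Type*} [AddCommGroup A] [LinearOrder A] [IsOrderedAddMonoid A]
    [Nontrivial A] [LinearOrder S] (ν : A → S) (hν : StrictMono ν) :
    -- the normal-play universe
    (∀ G H : CGame Unit,
      GameSpace.normalPlay.GameGE Set.univ G H ↔ GameSpace.normalPlay.CommonNormalPart Set.univ G H) ∧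
    -- the dicot misère universe
    (∀ G H : CGame Unit, CGame.IsDicot G → CGame.IsDicot H →
      (GameSpace.misere.GameGE {X | CGame.IsDicot X} G H ↔
        GameSpace.misere.CommonNormalPart {X | CGame.IsDicot X} G H ∧ GameSpace.misere.OutcomeGE G H)) ∧
    -- the free misère space
    (∀ G H : CGame Unit,
      GameSpace.misere.GameGE Set.univ G H ↔
        GameSpace.misere.CommonNormalPart Set.univ G H ∧
          (H.LeftAtomic → G.LeftAtomic) ∧ (G.RightAtomic → H.RightAtomic)) ∧
    -- the dicot scoring universe
    (∀ G H : CGame A, CGame.IsDicot G → CGame.IsDicot H →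
      ((GameSpace.scoringPlay ν hν).GameGE {X | CGame.IsDicot X} G H ↔
        (GameSpace.scoringPlay ν hν).CommonNormalPart {X | CGame.IsDicot X} G H ∧
          (GameSpace.scoringPlay ν hν).OutcomeGE G H)) ∧
    -- the guaranteed scoring universe; the minima and maxima exist
    (∀ G H : CGame A, CGame.IsGuaranteed G → CGame.IsGuaranteed H →
      ∃ gL hL gR hR : S,
        (GameSpace.scoringPlay ν hν).IsPassAllowedL G gL ∧ (GameSpace.scoringPlay ν hν).IsPassAllowedL H hL ∧
        (GameSpace.scoringPlay ν hν).IsPassAllowedR G gR ∧ (GameSpace.scoringPlay ν hν).IsPassAllowedR H hR ∧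
        ((GameSpace.scoringPlay ν hν).GameGE {X | CGame.IsGuaranteed X} G H ↔
          (GameSpace.scoringPlay ν hν).CommonNormalPart {X | CGame.IsGuaranteed X} G H ∧ gL ≥ hL ∧ gR ≥ hR)) := by
  refine ⟨GameSpace.gameGE_normalPlay_iff, GameSpace.gameGE_misere_isDicot_iff,
    GameSpace.gameGE_misere_univ_iff, GameSpace.gameGE_scoringPlay_isDicot_iff,
    fun G H hG hH => ?_⟩
  obtain ⟨gL, h₁⟩ := GameSpace.exists_isPassAllowedL (hν := hν) G
  obtain ⟨hL, h₂⟩ := GameSpace.exists_isPassAllowedL (hν := hν) H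
  obtain ⟨gR, h₃⟩ := GameSpace.exists_isPassAllowedR (hν := hν) G
  obtain ⟨hR, h₄⟩ := GameSpace.exists_isPassAllowedR (hν := hν) H
  exact ⟨gL, hL, gR, hR, h₁, h₂, h₃, h₄,
    GameSpace.gameGE_isGuaranteed_iff hG hH h₁ h₂ h₃ h₄⟩
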